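/- Let $p$ be a prime, let $\mathbb{F}_{p^n}$ be the finite field with $p^n$ elements, let $c \in \mathbb{F}_{p^n}^\times$, let $d > 1$ be an integer with $\gcd(d, p^n - 1) = 1$ and $p \nmid d$, and let $1 \le i < n$. For a function $F : \mathbb{F}_{p^n} \to \mathbb{F}_{p^n}$ let $$\beta_{F,c} = \max_{a, b \in \mathbb{F}_{p^n} \setminus \{0\}} \left| \left\{ (x, y) \in \mathbb{F}_{p^n}^2 \;\middle|\; F(x+y) - c\,F(x) = b,\ \ c\,F(x+y+a) - F(x+a) = c\,b \right\} \right|$$ be its $c$-boomerang uniformity. Then 1. $\beta_{x^{d \cdot p^i},\, c} \le d^2$; 2. $\beta_{x^{1/(d \cdot p^i)},\, c} \le d^2$, where $x^{1/(d \cdot p^i)}$ is the inverse of the permutation $x^{d \cdot p^i}$ of $\mathbb{F}_{p^n}$, that is, $x^e$ for the unique integer $1 \le e < p^n - 1$ with $e \cdot d \cdot p^i \equiv 1 \pmod{p^n - 1}$. -/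

import Mathlib

/-- The entry at `(a, b)` of the `c`-Boomerang Connectivity Table of `F : V → W`, where `V` and `W`
are finite vector spaces over a finite field `K` (for instance `V = W = K`): the number of pairs
`(x, y) ∈ V × V` with `F (x + y) - c F x = b` and `c F (x + y + a) - F (x + a) = c b`. -/
noncomputable def cBCT {K V W : Type*} [Field K] [AddCommGroup V] [Module K V] [Fintype V]
    [AddCommGroup W] [Module K W] (c : K) (F : V → W) (a : V) (b : W) : ℕ :=
  Set.ncard {xy : V × V | F (xy.1 + xy.2) - c • F xy.1 = b ∧
    c • F (xy.1 + xy.2 + a) - F (xy.1 + a) = c • b}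

open Classical in
/-- The `c`-boomerang uniformity of `F : V → W`: the maximum of the entries of the `c`-BCT over all
`a ∈ V ∖ {0}` and `b ∈ W ∖ {0}`. -/
noncomputable def cBoomerangUniformity {K V W : Type*} [Field K]
    [AddCommGroup V] [Module K V] [Fintype V]
    [AddCommGroup W] [Module K W] [Fintype W] (c : K) (F : V → W) : ℕ :=
  (Finset.univ.filter (fun ab : V × W => ab.1 ≠ 0 ∧ ab.2 ≠ 0)).sup
    (fun ab => cBCT c F ab.1 ab.2)

/-- The exponent `1 / m` over a field with `q` elements: the integer `1 ≤ e < q - 1` with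
`e * m ≡ 1 mod (q - 1)`. It exists and is unique when `2 < q` and `gcd (m, q - 1) = 1`, see
`inverseExponent_spec` and `eq_inverseExponent`. -/
noncomputable def inverseExponent (q m : ℕ) : ℕ :=
  sInf {e : ℕ | 1 ≤ e ∧ e < q - 1 ∧ e * m ≡ 1 [MOD (q - 1)]}

theorem inverseExponent_spec {q m : ℕ} (hq : 2 < q) (hm : Nat.Coprime m (q - 1)) :
    1 ≤ inverseExponent q m ∧ inverseExponent q m < q - 1 ∧
      inverseExponent q m * m ≡ 1 [MOD (q - 1)] := by
  have hne : {e : ℕ | 1 ≤ e ∧ e < q - 1 ∧ e * m ≡ 1 [MOD (q - 1)]}.Nonempty := by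
    obtain ⟨e, he, h⟩ := Nat.exists_mul_mod_eq_one_of_coprime hm (by omega)
    refine ⟨e, ?_, he, ?_⟩
    · rcases Nat.eq_zero_or_pos e with rfl | h0
      · simp at h
      · exact h0
    · rw [Nat.ModEq, Nat.mul_comm, h, Nat.mod_eq_of_lt (by omega)]
  exact Nat.sInf_mem hne

theorem eq_inverseExponent {q m e : ℕ} (hq : 2 < q) (hm : Nat.Coprime m (q - 1))
    (he : e < q - 1) (h : e * m ≡ 1 [MOD (q - 1)]) : e = inverseExponent q m := by
  obtain ⟨_, h2, h3⟩ := inverseExponent_spec hq hm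
  exact (Nat.ModEq.cancel_right_of_coprime (Nat.Coprime.symm hm) (h.trans h3.symm)).eq_of_lt_of_lt
    he h2

/-- `x ^ (1 / m)` is the inverse of the permutation `x ^ m`. -/
theorem pow_inverseExponent {K : Type*} [Field K] [Fintype K] {m : ℕ}
    (hq : 2 < Fintype.card K) (hm : Nat.Coprime m (Fintype.card K - 1)) (x : K) :
    (x ^ m) ^ inverseExponent (Fintype.card K) m = x ∧
      (x ^ inverseExponent (Fintype.card K) m) ^ m = x := by
  obtain ⟨h1, h2, h3⟩ := inverseExponent_spec hq hm
  have hm0 : m ≠ 0 := by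
    rintro rfl
    simp at hm
    omega
  have key : x ^ (inverseExponent (Fintype.card K) m * m) = x := by
    rcases eq_or_ne x 0 with rfl | hx
    · exact zero_pow (by positivity)
    · have hx1 := FiniteField.pow_card_sub_one_eq_one x hx
      rw [← Nat.mod_add_div (inverseExponent (Fintype.card K) m * m) (Fintype.card K - 1), h3,
        Nat.mod_eq_of_lt (by omega), pow_add, pow_mul, hx1]
      simp
  exact ⟨by rw [← pow_mul, Nat.mul_comm]; exact key, by rw [← pow_mul]; exact key⟩

/-! The inner factor `p ^ i` is a Frobenius power, hence additive and bijective, and can be stripped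
from both equations. For the power map and for its inverse, suitable coordinates then turn each
table entry into a count of common points of a Fermat curve `Y ^ d + A * X ^ d = c` and a translate
of another such curve, so Bézout's bound `d ^ 2` finishes (`ncard_fermat_inter_le`). The bound needs
no projective geometry (`card_le_sq_of_irreducible`): the products `f * v` and `g * w` together with
one interpolating polynomial per common point are independent in bounded total degree, and counting
dimensions leaves room for only `d ^ 2` points. The first curve is irreducible by Eisenstein
(`irreducible_fermat`). -/

open Polynomial

/-! ### Bivariate polynomials of bounded total degree. -/

section PlaneCurves

variable {K : Type*} [Field K]

/-- The monomials `X ^ i * Y ^ j`, as a `K`-basis of `K[X][Y]`. -/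
noncomputable def bivariateBasis (K : Type*) [Field K] : Module.Basis (ℕ × ℕ) K K[X][X] :=
  (Polynomial.basisMonomials K).smulTower (Polynomial.basisMonomials K[X])

theorem bivariateBasis_apply (ij : ℕ × ℕ) :
    bivariateBasis K ij = C (X ^ ij.1) * X ^ ij.2 := by
  simp [bivariateBasis, Module.Basis.smulTower_apply, ← Polynomial.X_pow_eq_monomial,
    Polynomial.smul_eq_C_mul]

/-- Exponents `(i, j)` with `i + j ≤ k` and `j < J`. -/
def boundedExponents (k J : ℕ) : Finset (ℕ × ℕ) :=
  (Finset.range (k + 1) ×ˢ Finset.range J).filter fun ij => ij.1 + ij.2 ≤ k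

theorem mem_boundedExponents {k J : ℕ} {ij : ℕ × ℕ} :
    ij ∈ boundedExponents k J ↔ ij.1 + ij.2 ≤ k ∧ ij.2 < J := by
  simp only [boundedExponents, Finset.mem_filter, Finset.mem_product, Finset.mem_range]
  omega

/-- A monomial is divisible by `Y ^ d`, or only by `X ^ d`, or lies in the `d × d` square of
remaining exponents; this square is the source of Bézout's number. -/
theorem card_boundedExponents_le (m d : ℕ) :
    (boundedExponents (m + d) (m + d + 1)).card ≤
      (boundedExponents m (m + 1)).card + (boundedExponents m d).card + d ^ 2 := by
  classical
  have hsub : boundedExponents (m + d) (m + d + 1) ⊆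
      ((boundedExponents m (m + 1)).image (fun ij => (ij.1, ij.2 + d)) ∪
        (boundedExponents m d).image (fun ij => (ij.1 + d, ij.2))) ∪
        Finset.range d ×ˢ Finset.range d := by
    rintro ⟨i, j⟩ h
    rw [mem_boundedExponents] at h
    simp only [Finset.mem_union, Finset.mem_image, mem_boundedExponents, Finset.mem_product,
      Finset.mem_range, Prod.mk.injEq, Prod.exists]
    rcases le_or_gt d j with hj | hj
    · exact Or.inl (Or.inl ⟨i, j - d, by omega, rfl, by omega⟩)
    · rcases le_or_gt d i with hi | hi
      · exact Or.inl (Or.inr ⟨i - d, j, by omega, by omega, rfl⟩)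
      · exact Or.inr ⟨hi, hj⟩
  refine (Finset.card_le_card hsub).trans ((Finset.card_union_le _ _).trans ?_)
  refine Nat.add_le_add ((Finset.card_union_le _ _).trans ?_) (by simp [sq])
  exact Nat.add_le_add Finset.card_image_le Finset.card_image_le

/-- Polynomials in `K[X][Y]` of total degree at most `k` and of degree less than `J` in `Y`. -/
noncomputable def boundedPolynomials (K : Type*) [Field K] (k J : ℕ) : Submodule K K[X][X] :=
  Submodule.span K (bivariateBasis K '' (boundedExponents k J))

instance (k J : ℕ) : Module.Finite K (boundedPolynomials K k J) :=
  Module.Finite.span_of_finite K ((Finset.finite_toSet _).image _)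

instance (k J : ℕ) : Module.Free K (boundedPolynomials K k J) :=
  Module.Free.of_divisionRing K (boundedPolynomials K k J)

theorem finrank_boundedPolynomials (k J : ℕ) :
    Module.finrank K (boundedPolynomials K k J) = (boundedExponents k J).card := by
  classical
  have h := finrank_span_finset_eq_card (R := K)
    (s := (boundedExponents k J).image (bivariateBasis K)) (by
      rw [Finset.coe_image]
      exact ((bivariateBasis K).linearIndependent.linearIndepOn _).id_image)
  rw [Finset.coe_image, Finset.card_image_of_injective _ (bivariateBasis K).injective] at h
  exact h

theorem boundedPolynomials_mono {k k' J J' : ℕ}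
    (h : ∀ i j, i + j ≤ k → j < J → i + j ≤ k' ∧ j < J') :
    boundedPolynomials K k J ≤ boundedPolynomials K k' J' := by
  refine Submodule.span_mono (Set.image_mono fun ij hij => ?_)
  rw [Finset.mem_coe, mem_boundedExponents] at hij ⊢
  exact h _ _ hij.1 hij.2

theorem degree_lt_of_mem_boundedPolynomials {k J : ℕ} {w : K[X][X]}
    (hw : w ∈ boundedPolynomials K k J) : w.degree < J := by
  rw [← Polynomial.mem_degreeLT]
  have : boundedPolynomials K k J ≤ (Polynomial.degreeLT K[X] J).restrictScalars K := by
    refine Submodule.span_le.2 ?_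
    rintro _ ⟨ij, hij, rfl⟩
    rw [Finset.mem_coe, mem_boundedExponents] at hij
    rw [SetLike.mem_coe, Submodule.restrictScalars_mem, Polynomial.mem_degreeLT,
      bivariateBasis_apply]
    exact (Polynomial.degree_C_mul_X_pow_le _ _).trans_lt (by exact_mod_cast hij.2)
  exact this hw

/-- Polynomials in `K[X][Y]` of total degree at most `k`. -/
noncomputable abbrev totalDegreeLE (K : Type*) [Field K] (k : ℕ) : Submodule K K[X][X] :=
  boundedPolynomials K k (k + 1)

theorem mul_mem_totalDegreeLE {k l : ℕ} {v w : K[X][X]} (hv : v ∈ totalDegreeLE K k)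
    (hw : w ∈ totalDegreeLE K l) : v * w ∈ totalDegreeLE K (k + l) := by
  have h := Submodule.mul_mem_mul hv hw
  unfold totalDegreeLE boundedPolynomials at h
  rw [Submodule.span_mul_span] at h
  refine Submodule.span_le.2 ?_ h
  rintro _ ⟨_, ⟨ij, hij, rfl⟩, _, ⟨ij', hij', rfl⟩, rfl⟩
  rw [Finset.mem_coe, mem_boundedExponents] at hij hij'
  refine Submodule.subset_span ⟨ij + ij', ?_, ?_⟩
  · rw [Finset.mem_coe, mem_boundedExponents, Prod.fst_add, Prod.snd_add]
    omega
  · simp only [bivariateBasis_apply, Prod.fst_add, Prod.snd_add, pow_add, C_mul]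
    ring

theorem totalDegreeLE_mono {k l : ℕ} (h : k ≤ l) : totalDegreeLE K k ≤ totalDegreeLE K l :=
  boundedPolynomials_mono fun _ _ _ _ => by omega

theorem monomial_mem_totalDegreeLE {k i j : ℕ} (h : i + j ≤ k) :
    (C (X ^ i) * X ^ j : K[X][X]) ∈ totalDegreeLE K k := by
  rw [← bivariateBasis_apply (i, j)]
  refine Submodule.subset_span ⟨_, ?_, rfl⟩
  rw [Finset.mem_coe, mem_boundedExponents]
  simp only
  omega

theorem C_C_mem_totalDegreeLE (k : ℕ) (a : K) : (C (C a) : K[X][X]) ∈ totalDegreeLE K k := by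
  have h := (totalDegreeLE K k).smul_mem a
    (monomial_mem_totalDegreeLE (K := K) (i := 0) (j := 0) (Nat.zero_le k))
  rwa [pow_zero, pow_zero, C_1, one_mul, Algebra.smul_def, mul_one] at h

theorem C_X_mem_totalDegreeLE : (C X : K[X][X]) ∈ totalDegreeLE K 1 := by
  simpa using monomial_mem_totalDegreeLE (K := K) (i := 1) (j := 0) le_rfl

theorem X_mem_totalDegreeLE : (X : K[X][X]) ∈ totalDegreeLE K 1 := by
  simpa using monomial_mem_totalDegreeLE (K := K) (i := 0) (j := 1) le_rfl

theorem prod_mem_totalDegreeLE {ι : Type*} (s : Finset ι) {v : ι → K[X][X]}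
    (hv : ∀ x ∈ s, v x ∈ totalDegreeLE K 1) : ∏ x ∈ s, v x ∈ totalDegreeLE K s.card := by
  classical
  induction s using Finset.induction_on with
  | empty => simpa using C_C_mem_totalDegreeLE 0 (1 : K)
  | insert x s hx ih =>
    rw [Finset.prod_insert hx, Finset.card_insert_of_notMem hx, add_comm]
    exact mul_mem_totalDegreeLE (hv x (Finset.mem_insert_self x s))
      (ih fun y hy => hv y (Finset.mem_insert_of_mem hy))

theorem pow_mem_totalDegreeLE {v : K[X][X]} (hv : v ∈ totalDegreeLE K 1) (d : ℕ) :
    v ^ d ∈ totalDegreeLE K d := by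
  simpa using prod_mem_totalDegreeLE (Finset.range d) (v := fun _ => v) fun _ _ => hv

/-! ### Bézout's bound by a dimension count. -/

/-- A polynomial of total degree at most `|P|` that separates a point from the other points of
a finite set. -/
theorem exists_separating_polynomial (P : Finset (K × K)) (z : K × K) :
    ∃ e ∈ totalDegreeLE K P.card, e.evalEval z.1 z.2 ≠ 0 ∧
      ∀ z' ∈ P, z' ≠ z → e.evalEval z'.1 z'.2 = 0 := by
  classical
  -- A line through `z'` that misses `z` whenever `z' ≠ z`: horizontal if the abscissas agree,
  -- vertical otherwise.
  let l : K × K → K[X][X] := fun z' =>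
    if z'.1 = z.1 then X - C (C z'.2) else C X - C (C z'.1)
  have hl : ∀ z', l z' ∈ totalDegreeLE K 1 := by
    intro z'
    simp only [l]
    split_ifs
    · exact Submodule.sub_mem _ X_mem_totalDegreeLE (C_C_mem_totalDegreeLE _ _)
    · exact Submodule.sub_mem _ C_X_mem_totalDegreeLE (C_C_mem_totalDegreeLE _ _)
  refine ⟨∏ z' ∈ P.erase z, l z', totalDegreeLE_mono (Finset.card_erase_le)
    (prod_mem_totalDegreeLE _ fun x _ => hl x), ?_, ?_⟩
  · rw [← coe_evalEvalRingHom, map_prod, Finset.prod_ne_zero_iff]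
    intro z' hz'
    have hne := (Finset.mem_erase.1 hz').1
    by_cases h : z'.1 = z.1
    · have h2 : z'.2 ≠ z.2 := fun h2 => hne (Prod.ext h h2)
      simpa [l, h, evalEval, sub_eq_zero] using h2.symm
    · simpa [l, h, evalEval, sub_eq_zero] using Ne.symm h
  · intro z' hz' hne
    rw [← coe_evalEvalRingHom, map_prod]
    refine Finset.prod_eq_zero (Finset.mem_erase.2 ⟨hne, hz'⟩) ?_
    by_cases h : z'.1 = z.1 <;> simp [l, h]

/-- Bézout's bound for two plane curves of degree at most `d`, one of which is irreducible and of
degree `d` in `Y`. -/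
theorem card_le_sq_of_irreducible {d : ℕ} {f g : K[X][X]} (hf : Irreducible f)
    (hfd : f.degree = d) (hfm : f ∈ totalDegreeLE K d) (hgm : g ∈ totalDegreeLE K d)
    (hfg : ¬ f ∣ g) (P : Finset (K × K))
    (hP : ∀ z ∈ P, f.evalEval z.1 z.2 = 0 ∧ g.evalEval z.1 z.2 = 0) : P.card ≤ d ^ 2 := by
  classical
  choose e he hne hzero using exists_separating_polynomial P
  set m := P.card
  -- Restricting `w` to `Y`-degree below `d = deg f` removes the syzygies between `f` and `g`, such
  -- as `f * g - g * f = 0`.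
  let φ : (totalDegreeLE K m × boundedPolynomials K m d) × (P → K) →ₗ[K] K[X][X] :=
    (((LinearMap.mulLeft K f).comp (Submodule.subtype _)).coprod
      ((LinearMap.mulLeft K g).comp (Submodule.subtype _))).coprod
      (Fintype.linearCombination K fun z : P => e z)
  have hφ : ∀ v w c, φ ((v, w), c) = f * v + g * w + ∑ z : P, c z • e z := by
    intro v w c
    simp [φ, Fintype.linearCombination_apply]
  have hW : boundedPolynomials K m d ≤ totalDegreeLE K m :=
    boundedPolynomials_mono fun _ _ _ _ => by omega
  have hmem : ∀ x, φ x ∈ totalDegreeLE K (m + d) := by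
    rintro ⟨⟨v, w⟩, c⟩
    rw [hφ]
    refine add_mem (add_mem ?_ ?_) (Submodule.sum_mem _ fun z _ => Submodule.smul_mem _ _ ?_)
    · rw [add_comm m]; exact mul_mem_totalDegreeLE hfm v.2
    · rw [add_comm m]; exact mul_mem_totalDegreeLE hgm (hW w.2)
    · exact totalDegreeLE_mono (Nat.le_add_right _ _) (he z)
  have hinj : Function.Injective φ := by
    rw [injective_iff_map_eq_zero]
    rintro ⟨⟨v, w⟩, c⟩ h
    rw [hφ] at h
    -- At a point `z` of `P`, both curves and every `e z'` with `z' ≠ z` vanish, which isolates `c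
    -- z`.
    have hc : c = 0 := by
      funext z
      have h1 := congrArg (evalEvalRingHom (z : K × K).1 (z : K × K).2) h
      obtain ⟨h2, h3⟩ := hP z z.2
      rw [map_add, map_add, map_mul, map_mul, map_sum, map_zero, coe_evalEvalRingHom, h2, h3,
        zero_mul, zero_mul, zero_add, zero_add, Finset.sum_eq_single z] at h1
      · rw [Algebra.smul_def, evalEval_mul] at h1
        have h4 : (algebraMap K K[X][X] (c z)).evalEval (z : K × K).1 (z : K × K).2 = c z := by
          rw [show algebraMap K K[X][X] (c z) = C (C (c z)) from rfl]
          simp [evalEval]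
        rw [h4] at h1
        exact (mul_eq_zero.1 h1).resolve_right (hne z)
      · intro z' _ hz'
        rw [Algebra.smul_def, evalEval_mul,
          hzero z' z z.2 (fun h => hz' (Subtype.ext h.symm)), mul_zero]
      · simp
    subst hc
    simp only [Pi.zero_apply, zero_smul, Finset.sum_const_zero, add_zero] at h
    have hdvd : f ∣ g * w := ⟨-v, by linear_combination h⟩
    have hw : (w : K[X][X]) = 0 := by
      refine Polynomial.eq_zero_of_dvd_of_degree_lt ((hf.prime.dvd_or_dvd hdvd).resolve_left hfg) ?_
      rw [hfd]
      exact degree_lt_of_mem_boundedPolynomials w.2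
    rw [hw, mul_zero, add_zero, mul_eq_zero] at h
    have hv : (v : K[X][X]) = 0 := h.resolve_left hf.ne_zero
    ext1
    · exact Prod.ext (Subtype.ext hv) (Subtype.ext hw)
    · rfl
  have hrank := LinearMap.finrank_le_finrank_of_injective (f := φ.codRestrict _ hmem)
    (fun x y hxy => hinj (congrArg Subtype.val hxy))
  rw [Module.finrank_prod, Module.finrank_prod, finrank_boundedPolynomials,
    finrank_boundedPolynomials, finrank_boundedPolynomials, Module.finrank_pi,
    Fintype.card_coe] at hrank
  have := card_boundedExponents_le m d
  omega

/-! ### Fermat curves. -/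

/-- The Fermat type polynomial `Y ^ d + A * X ^ d - c` is irreducible. -/
theorem irreducible_fermat {d : ℕ} (hd : 0 < d) (hdK : (d : K) ≠ 0) {A c : K} (hA : A ≠ 0)
    (hc : c ≠ 0) : Irreducible (X ^ d + C (C A * X ^ d - C c) : K[X][X]) := by
  set r : K[X] := C A * X ^ d - C c with hr
  have hrdeg : r.natDegree = d := by
    rw [hr, Polynomial.natDegree_sub_C, Polynomial.natDegree_C_mul_X_pow _ _ hA]
  have hr0 : r ≠ 0 := by
    intro h
    rw [h, natDegree_zero] at hrdeg
    omega
  have hrunit : ¬ IsUnit r := fun h => by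
    have := Polynomial.natDegree_eq_zero_of_isUnit h
    omega
  have hsep : r.Separable := by
    -- Euler's relation `X * r' = d * (r + c)` gives the Bézout coefficients.
    refine ⟨C (-c⁻¹), C (c⁻¹ * (d : K)⁻¹) * X, ?_⟩
    have hder : derivative r = C A * (C (d : K) * X ^ (d - 1)) := by
      rw [hr, derivative_sub, derivative_C, sub_zero, derivative_C_mul, derivative_X_pow]
    rw [hder, hr, ← Nat.sub_add_cancel hd, Nat.add_sub_cancel, pow_succ]
    have h1 : (C (c⁻¹) * C c : K[X]) = 1 := by rw [← C_mul, inv_mul_cancel₀ hc, C_1]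
    have h2 : (C ((d : K)⁻¹) * C (d : K) : K[X]) = 1 := by
      rw [← C_mul, inv_mul_cancel₀ hdK, C_1]
    rw [Nat.sub_add_cancel hd]
    simp only [C_mul, C_neg]
    linear_combination h1 + C c⁻¹ * X ^ (d - 1) * X * C A * h2
  -- Eisenstein applies at `π`, since the separable `r` is squarefree.
  obtain ⟨π, hπ, hπr⟩ := WfDvdMonoid.exists_irreducible_factor hrunit hr0
  have hmonic : (X ^ d + C r : K[X][X]).Monic := monic_X_pow_add_C r hd.ne'
  have hnat : (X ^ d + C r : K[X][X]).natDegree = d := natDegree_X_pow_add_C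
  have hdegree : (X ^ d + C r : K[X][X]).degree = d := degree_X_pow_add_C hd r
  refine Polynomial.irreducible_of_eisenstein_criterion (P := Ideal.span {π})
    ((Ideal.span_singleton_prime hπ.ne_zero).2 hπ.prime) ?_ ?_ ?_ ?_ hmonic.isPrimitive
  · rw [hmonic.leadingCoeff, Ideal.mem_span_singleton]
    exact fun h => hπ.not_isUnit (isUnit_of_dvd_one h)
  · intro j hj
    rw [hdegree] at hj
    have hj' : j < d := by exact_mod_cast hj
    rw [coeff_add, coeff_X_pow, if_neg hj'.ne, zero_add, coeff_C, Ideal.mem_span_singleton]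
    split_ifs
    · exact hπr
    · exact dvd_zero _
  · rw [hdegree]; exact_mod_cast hd
  · rw [Ideal.span_singleton_pow, Ideal.mem_span_singleton, coeff_add, coeff_X_pow,
      if_neg hd.ne, zero_add, coeff_C_zero, sq]
    exact fun h => hπ.not_isUnit (hsep.squarefree π h)

/-- A Fermat curve of degree `d` and a translate of another one meet in at most `d ^ 2` points. -/
theorem ncard_fermat_inter_le {d : ℕ} (hd : 1 < d) (hdK : (d : K) ≠ 0) {A c A' B' c' s t : K}
    (hA : A ≠ 0) (hc : c ≠ 0) (hA' : A' ≠ 0) (hs : s ≠ 0) :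
    {z : K × K | z.2 ^ d + A * z.1 ^ d = c ∧
      A' * (z.1 + s) ^ d + B' * (z.2 + t) ^ d = c'}.ncard ≤ d ^ 2 := by
  by_cases hfin : {z : K × K | z.2 ^ d + A * z.1 ^ d = c ∧
      A' * (z.1 + s) ^ d + B' * (z.2 + t) ^ d = c'}.Finite
  swap
  -- An infinite set has `ncard` equal to `0` by convention.
  · rw [Set.Infinite.ncard hfin]; exact Nat.zero_le _
  rw [Set.ncard_eq_toFinset_card _ hfin]
  have hd0 : 0 < d := by omega
  set f : K[X][X] := X ^ d + C (C A * X ^ d - C c) with hf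
  set g : K[X][X] := C (C A' * (X + C s) ^ d - C c') + C (C B') * (X + C (C t)) ^ d with hg
  have hCC := fun (k : ℕ) (a : K) => C_C_mem_totalDegreeLE k a
  have hCCmul : ∀ (a : K) {v : K[X][X]}, v ∈ totalDegreeLE K d →
      C (C a) * v ∈ totalDegreeLE K d := fun a v hv => by
    simpa using mul_mem_totalDegreeLE (hCC 0 a) hv
  have hfm : f ∈ totalDegreeLE K d := by
    rw [hf]
    simp only [C_sub, C_mul, C_pow]
    exact add_mem (pow_mem_totalDegreeLE X_mem_totalDegreeLE d)
      (sub_mem (hCCmul _ (pow_mem_totalDegreeLE C_X_mem_totalDegreeLE d)) (hCC d c))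
  have hgm : g ∈ totalDegreeLE K d := by
    rw [hg]
    simp only [C_sub, C_mul, C_pow, C_add]
    exact add_mem (sub_mem (hCCmul _ (pow_mem_totalDegreeLE
      (add_mem C_X_mem_totalDegreeLE (hCC 1 s)) d)) (hCC d c'))
      (hCCmul _ (pow_mem_totalDegreeLE (add_mem X_mem_totalDegreeLE (hCC 1 t)) d))
  refine card_le_sq_of_irreducible (irreducible_fermat hd0 hdK hA hc)
    (degree_X_pow_add_C hd0 _) hfm hgm ?_ _ ?_
  · rintro ⟨h, hh⟩
    have hfmonic : f.Monic := monic_X_pow_add_C _ hd0.ne'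
    have hfnat : f.natDegree = d := natDegree_X_pow_add_C
    have hgnat : g.natDegree ≤ d := by
      rw [hg]
      refine natDegree_C_add.trans_le ((natDegree_C_mul_le _ _).trans ?_)
      rw [natDegree_pow_X_add_C]
    have hhnat : h.natDegree = 0 := by
      rcases eq_or_ne h 0 with rfl | h0
      · exact natDegree_zero
      · rw [hh, hfmonic.natDegree_mul' h0, hfnat] at hgnat
        omega
    obtain ⟨u, rfl⟩ := natDegree_eq_zero.1 hhnat
    have hu : u = C B' := by
      have h1 := congrArg (fun q : K[X][X] => q.coeff d) hh
      simp only [hg, coeff_mul_C, coeff_add, coeff_C_mul, coeff_X_pow, coeff_C,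
        if_neg hd0.ne', if_true, coeff_X_add_C_pow, Nat.sub_self, pow_zero, Nat.choose_self] at h1
      simpa using h1.symm
    subst hu
    have hd1 : d - (d - 1) = 1 := by omega
    have hd2 : d.choose (d - 1) = d := by
      rw [Nat.choose_symm_of_eq_add (show d = (d - 1) + 1 by omega), Nat.choose_one_right]
    have ht : ((C t : K[X]) ^ d).coeff (d - 1) = 0 := by
      rw [← C_pow, coeff_C, if_neg (by omega)]
    -- The coefficient of `X ^ (d - 1) * Y ^ 0` is `A' * s * d` in `g` but `0` in `f * B'`, because
    -- `0 < d - 1 < d`.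
    have h1 := congrArg (fun q : K[X][X] => (q.coeff 0).coeff (d - 1)) hh
    simp only [hg, coeff_mul_C, coeff_add, coeff_C_mul, coeff_X_pow, coeff_C_zero,
      coeff_X_add_C_pow, if_neg hd0.ne, Nat.sub_zero, Nat.choose_zero_right, Nat.cast_one, mul_one,
      ht, mul_zero, add_zero, zero_add] at h1
    simp only [coeff_sub, coeff_C_mul, coeff_X_add_C_pow, coeff_X_pow, hd1, hd2, pow_one, coeff_C,
      if_neg (show d - 1 ≠ 0 by omega), if_neg (show d - 1 ≠ d by omega), mul_zero, sub_zero,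
      zero_mul] at h1
    exact mul_ne_zero hA' (mul_ne_zero hs hdK) h1
  · intro z hz
    obtain ⟨h1, h2⟩ := (hfin.mem_toFinset).1 hz
    constructor
    · simp [evalEval]; linear_combination h1
    · simp [hg, evalEval]; linear_combination h2

end PlaneCurves

/-! ### From boomerang systems to Fermat curves. -/

theorem cBoomerangUniformity_le {K : Type*} [Field K] [Fintype K] {c : K} {F : K → K} {N : ℕ}
    (h : ∀ a b, a ≠ 0 → b ≠ 0 → cBCT c F a b ≤ N) : cBoomerangUniformity c F ≤ N := by
  classical
  refine Finset.sup_le fun ab hab => ?_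
  rw [Finset.mem_filter] at hab
  exact h _ _ hab.2.1 hab.2.2

theorem cBoomerangUniformity_pow_mul_le {K : Type*} [Field K] [Fintype K] {p : ℕ} [CharP K p]
    [Fact p.Prime] {c : K} (hc : c ≠ 0) {d : ℕ} (hd : 1 < d) (hpd : ¬ p ∣ d) (i : ℕ) :
    cBoomerangUniformity c (fun x : K => x ^ (d * p ^ i)) ≤ d ^ 2 := by
  refine cBoomerangUniformity_le fun a b ha hb => ?_
  have hdK : (d : K) ≠ 0 := fun h => hpd ((CharP.cast_eq_zero_iff K p d).1 h)
  have hinj : Function.Injective (fun x : K => x ^ p ^ i) := iterateFrobenius_inj K p i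
  obtain ⟨γ, rfl⟩ := (Finite.surjective_of_injective hinj) c
  obtain ⟨β, rfl⟩ := (Finite.surjective_of_injective hinj) b
  have hpi : p ^ i ≠ 0 := pow_ne_zero _ (Fact.out : p.Prime).ne_zero
  have hγ : γ ≠ 0 := fun h => hc (by simp only [h, zero_pow hpi])
  have hβ : β ≠ 0 := fun h => hb (by simp only [h, zero_pow hpi])
  -- After extracting `p ^ i`-th roots, the system in the coordinates `(x, x + y)` is a pair of
  -- Fermat curves, the second shifted by `(a, a)`.
  refine le_trans ?_ (ncard_fermat_inter_le (A := -γ) (c := β) (A' := -1) (B' := γ)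
    (c' := γ * β) (s := a) (t := a) hd hdK (neg_ne_zero.2 hγ) hβ (by simp) ha)
  refine Set.ncard_le_ncard_of_injOn (fun xy => (xy.1, xy.1 + xy.2)) ?_ ?_ (Set.toFinite _)
  · rintro ⟨x, y⟩ ⟨h1, h2⟩
    simp only [smul_eq_mul, pow_mul, ← mul_pow, ← sub_pow_char_pow] at h1 h2
    have h1 := hinj h1
    have h2 := hinj h2
    simp only [Set.mem_ofPred_eq]
    exact ⟨by linear_combination h1, by linear_combination h2⟩
  · rintro ⟨x, y⟩ _ ⟨x', y'⟩ _ h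
    simp only [Prod.mk.injEq] at h ⊢
    obtain ⟨rfl, h⟩ := h
    exact ⟨rfl, add_left_cancel h⟩

theorem cBoomerangUniformity_pow_mul_inverse_le {K : Type*} [Field K] [Fintype K] {p : ℕ}
    [CharP K p] [Fact p.Prime] {c : K} (hc : c ≠ 0) {d : ℕ} (hd : 1 < d) (hpd : ¬ p ∣ d) (i : ℕ)
    {G : K → K} (hG : ∀ x, G x ^ (d * p ^ i) = x) : cBoomerangUniformity c G ≤ d ^ 2 := by
  refine cBoomerangUniformity_le fun a b ha hb => ?_
  have hdK : (d : K) ≠ 0 := fun h => hpd ((CharP.cast_eq_zero_iff K p d).1 h)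
  have hinj : Function.Injective (fun x : K => x ^ p ^ i) := iterateFrobenius_inj K p i
  obtain ⟨α, rfl⟩ := (Finite.surjective_of_injective hinj) a
  have hpi : p ^ i ≠ 0 := pow_ne_zero _ (Fact.out : p.Prime).ne_zero
  have hα : α ≠ 0 := fun h => ha (by simp only [h, zero_pow hpi])
  have hGinj : Function.Injective G := fun x y h => by rw [← hG x, ← hG y, h]
  -- A shift of the argument of `G` becomes a shift of its `d`-th power; applied at `x` and at `x +
  -- y`, this yields the two curves.
  have hshift : ∀ x, G (x + α ^ p ^ i) ^ d = G x ^ d + α := fun x => hinj (by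
    simp only [add_pow_char_pow, ← pow_mul, hG])
  refine le_trans ?_ (ncard_fermat_inter_le (A := -c ^ d) (c := -α) (A' := 1) (B' := -c ^ d)
    (c' := α) (s := b) (t := b / c) hd hdK (neg_ne_zero.2 (pow_ne_zero d hc)) (neg_ne_zero.2 hα)
    one_ne_zero hb)
  refine Set.ncard_le_ncard_of_injOn
    (fun xy => (G (xy.1 + xy.2 + α ^ p ^ i) - b, G xy.1)) ?_ ?_ (Set.toFinite _)
  · rintro ⟨x, y⟩ ⟨h1, h2⟩
    simp only [smul_eq_mul] at h1 h2
    -- In the coordinates `X = G (x + y + α ^ p ^ i) - b` and `Y = G x`, all four values of `G` are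
    -- affine: `Y`, `c * X`, `X + b` and `c * (Y + b / c)`.
    have h3 : c * (G (x + y + α ^ p ^ i) - b) = G (x + α ^ p ^ i) := by linear_combination h2
    have h4 : c * (G x + b / c) = G (x + y) := by
      rw [mul_add, mul_div_cancel₀ _ hc]; linear_combination -h1
    simp only [Set.mem_ofPred_eq, neg_mul, ← mul_pow, h3, h4, sub_add_cancel, hshift]
    constructor <;> ring
  · rintro ⟨x, y⟩ _ ⟨x', y'⟩ _ h
    simp only [Prod.mk.injEq] at h ⊢
    obtain ⟨h1, h2⟩ := h
    obtain rfl := hGinj h2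
    exact ⟨rfl, add_left_cancel (add_right_cancel (hGinj (sub_left_injective h1)))⟩

theorem mainTheorem7 {K : Type*} [Field K] [Fintype K] (p n : ℕ) (hp : p.Prime)
    (hK : Fintype.card K = p ^ n) (c : K) (hc : c ≠ 0)
    (d : ℕ) (hd : 1 < d) (hgcd : Nat.gcd d (p ^ n - 1) = 1) (hpd : ¬ p ∣ d)
    (i : ℕ) (hi : 1 ≤ i) (hin : i < n) :
    cBoomerangUniformity c (fun x : K => x ^ (d * p ^ i)) ≤ d ^ 2 ∧
    cBoomerangUniformity c (fun x : K => x ^ inverseExponent (p ^ n) (d * p ^ i)) ≤ d ^ 2 := by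
  have : Fact p.Prime := ⟨hp⟩
  have : CharP K p := charP_of_card_eq_prime_pow hK
  refine ⟨cBoomerangUniformity_pow_mul_le hc hd hpd i,
    cBoomerangUniformity_pow_mul_inverse_le hc hd hpd i fun x => ?_⟩
  -- From `1 ≤ i < n` follows `n ≥ 2`, so `p ^ n ≥ 4`.
  have hq : 2 < p ^ n := by
    have h1 : p ^ 2 ≤ p ^ n := Nat.pow_le_pow_right hp.pos (by omega)
    have h2 := hp.two_le
    nlinarith
  have hpq : Nat.Coprime p (p ^ n - 1) := by
    rw [hp.coprime_iff_not_dvd]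
    intro h
    have h1 : p ∣ p ^ n := dvd_pow_self p (by omega)
    have h2 := (Nat.dvd_sub_iff_right (by omega) h1).1 h
    exact hp.one_lt.ne' (Nat.dvd_one.1 h2)
  rw [← hK] at hq hgcd hpq ⊢
  exact (pow_inverseExponent hq (Nat.Coprime.mul_left hgcd (hpq.pow_left i)) x).2
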